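/- Let $\mathbb F=\mathbb F_p$ be a prime field. A quantum query algorithm with oracle access to a matrix $M\in\mathbb F^{m\times n}$ and a vector $v\in\mathbb F^n$ is a finite sequence of input-independent unitaries and calls of the oracles $U_M|i,j,z\rangle=|i,j,z+M_{ij}\rangle$ and $U_v|j,z\rangle=|j,z+v_j\rangle$, applied to a fixed initial basis state $|0\rangle$ on finitely many registers. Its success probability $\Pr_{\mathsf{ALG}}[\mathsf{ALG}^{M,v}=Mv]=\|\Pi_{Mv}\,\mathsf{ALG}^{M,v}|0\rangle\|^2$ is the probability that measuring its output register in the standard basis at the end gives $Mv$. There is an absolute constant $C>0$ such that the following holds for every prime $p$, all integers $n\ge 1$, $k\ge 1$ with $k\mid n$, and every $\alpha\in(0,1]$ with $\alpha\ge 4\exp(-k/3200)$. Put $d=n/k$, and let $\mathsf{ALG}$ be a quantum query algorithm with oracle access to $M\in\mathbb F^{n\times n}$ and $v\in\mathbb F^n$ that makes at most $Q(n)$ queries to $U_M$. Call $v\in\mathbb F^n$ good if $$\Pr_{M\sim\mathbb F^{n\times n},\ \mathsf{ALG}}\left[\mathsf{ALG}^{M,v}=Mv\right]=\mathbb E_{M\sim\mathbb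 F^{n\times n}}\left[\left\|\Pi_{Mv}\,\mathsf{ALG}^{M,v}|0\rangle\right\|^2\right]\ge\frac{\alpha}{2},$$ with $M$ uniformly random. Then there is a quantum query algorithm $\mathsf{ALG}_1$ with oracle access to $M\in\mathbb F^{d\times n}$ and $v\in\mathbb F^n$ that makes at most $C\,\alpha^{-1}\,(Q(n)+n^{3/2})$ queries to $U_M$ and satisfies, for every good $v\in\mathbb F^n$, $$\Pr_{M\sim\mathbb F^{d\times n}}\left[\Pr_{\mathsf{ALG}_1}\left[\mathsf{ALG}_1^{M,v}=Mv\right]\ge 0.99\right]\ge 0.99 .$$ -/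

import Mathlib

/-- Basis states of a quantum query algorithm with oracle access to an `m × n` matrix and a vector
of length `n` over `ZMod p`. The registers are, in this order: row index, column index, oracle
answer, output register (holding a vector of length `m`), workspace `W`. -/
abbrev QBasis (p m n : ℕ) (W : Type) : Type :=
  Fin m × Fin n × ZMod p × (Fin m → ZMod p) × W

/-- The matrix oracle `U_M |i, j, z⟩ = |i, j, z + M i j⟩`, tensored with the identity on the
output register and the workspace, as a permutation of the basis states. -/
def matOracle {p m n : ℕ} {W : Type} (M : Matrix (Fin m) (Fin n) (ZMod p)) :
    Equiv.Perm (QBasis p m n W) where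
  toFun := fun (i, j, z, y, w) => (i, j, z + M i j, y, w)
  invFun := fun (i, j, z, y, w) => (i, j, z - M i j, y, w)
  left_inv := by rintro ⟨i, j, z, y, w⟩; simp
  right_inv := by rintro ⟨i, j, z, y, w⟩; simp

/-- The vector oracle `U_v |j, z⟩ = |j, z + v j⟩` on the column and answer registers, tensored with
the identity on the other registers, as a permutation of the basis states. -/
def vecOracle {p m n : ℕ} {W : Type} (v : Fin n → ZMod p) :
    Equiv.Perm (QBasis p m n W) where
  toFun := fun (i, j, z, y, w) => (i, j, z + v j, y, w)
  invFun := fun (i, j, z, y, w) => (i, j, z - v j, y, w)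
  left_inv := by rintro ⟨i, j, z, y, w⟩; simp
  right_inv := by rintro ⟨i, j, z, y, w⟩; simp

/-- One step of a quantum query algorithm on the basis states `B`: an arbitrary unitary that does
not depend on the input, one call of the matrix oracle, or one call of the vector oracle. -/
inductive QStep (B : Type) [Fintype B] [DecidableEq B] : Type where
  | gate (U : Matrix.unitaryGroup B ℂ) : QStep B
  | queryMat : QStep B
  | queryVec : QStep B

/-- Whether a step is a call of the matrix oracle. -/
def QStep.isQueryMat {B : Type} [Fintype B] [DecidableEq B] : QStep B → Bool
  | .gate _ => false
  | .queryMat => true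
  | .queryVec => false

/-- A quantum query algorithm with oracle access to an `m × n` matrix and a vector of length `n`
over `ZMod p`, which outputs a vector of length `m`: a finite workspace, an initial basis state, and
a finite sequence of steps. None of these depends on the matrix or on the vector. -/
structure QueryAlg (p m n : ℕ) [Fact p.Prime] : Type 1 where
  W : Type
  [fintypeW : Fintype W]
  [decEqW : DecidableEq W]
  start : QBasis p m n W
  steps : List (QStep (QBasis p m n W))

attribute [instance] QueryAlg.fintypeW QueryAlg.decEqW

/-- The action of one step on a vector of amplitudes. A basis permutation `π` acts as the unitary
`|b⟩ ↦ |π b⟩`. -/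
noncomputable def QStep.apply {p m n : ℕ} [Fact p.Prime] {W : Type} [Fintype W] [DecidableEq W]
    (M : Matrix (Fin m) (Fin n) (ZMod p)) (v : Fin n → ZMod p)
    (ψ : QBasis p m n W → ℂ) : QStep (QBasis p m n W) → (QBasis p m n W → ℂ)
  | .gate U => Matrix.mulVec (U : Matrix (QBasis p m n W) (QBasis p m n W) ℂ) ψ
  | .queryMat => fun b => ψ ((matOracle M).symm b)
  | .queryVec => fun b => ψ ((vecOracle v).symm b)

namespace QueryAlg

variable {p m n : ℕ} [Fact p.Prime]

/-- The number of queries to the matrix oracle `U_M`. -/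
def matQueries (A : QueryAlg p m n) : ℕ := A.steps.countP QStep.isQueryMat

/-- The final state `ALG^{M,v} |0⟩`. -/
noncomputable def finalState (A : QueryAlg p m n) (M : Matrix (Fin m) (Fin n) (ZMod p))
    (v : Fin n → ZMod p) : QBasis p m n A.W → ℂ :=
  A.steps.foldl (fun ψ s => s.apply M v ψ) (Pi.single A.start 1)

/-- The probability that measuring the output register of the final state in the standard basis
gives `y`, that is, `‖Π_y ALG^{M,v} |0⟩‖ ^ 2`. -/
noncomputable def outputProb (A : QueryAlg p m n) (M : Matrix (Fin m) (Fin n) (ZMod p))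
    (v : Fin n → ZMod p) (y : Fin m → ZMod p) : ℝ :=
  ∑ b : QBasis p m n A.W, if b.2.2.2.1 = y then ‖A.finalState M v b‖ ^ 2 else 0

/-- The probability that the algorithm outputs `M v` on input `M, v`. -/
noncomputable def successProb (A : QueryAlg p m n) (M : Matrix (Fin m) (Fin n) (ZMod p))
    (v : Fin n → ZMod p) : ℝ :=
  A.outputProb M v (M.mulVec v)

/-- `v` is good for the algorithm and `α`: for a uniformly random matrix `M`, the algorithm outputs
`M v` with probability at least `α / 2`, over `M` and the measurement. -/
def IsGood (A : QueryAlg p m n) (α : ℝ) (v : Fin n → ZMod p) : Prop :=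
  α / 2 ≤ (∑ M : Matrix (Fin m) (Fin n) (ZMod p), A.successProb M v) /
    (Fintype.card (Matrix (Fin m) (Fin n) (ZMod p)) : ℝ)

end QueryAlg

/-- The probability of the event `E` under the uniform distribution on a finite type. -/
noncomputable def uniformProb {Ω : Type} [Fintype Ω] (E : Ω → Prop) : ℝ :=
  (Nat.card {x : Ω // E x} : ℝ) / (Fintype.card Ω : ℝ)

/-!
The reduction rests on two observations about `M ↦ M v`.

**Random self-reducibility.** View `n × n` matrices as `k` blocks of `d` rows. For a `d × n` matrix
`M`, choose a block `I` and an `n × n` matrix `N` uniformly at random. Then `X = N + plantBlock I M`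
is uniform and independent of `I`, whatever `M` is, and `M v` is block `I` of `X v` minus block `I` of
`N v`. So the average-case guarantee of the given algorithm applies to each `M`, and the reduction
succeeds for all `M`.

**Visible errors.** The algorithm may be wrong with probability close to `1`, and its answer in block
`I` cannot be checked cheaply. All other blocks of `X v` are known without any matrix query. Let `A`
be the set of wrong blocks. If `A` is a small fraction of the blocks, a random `I` is rarely in `A`;
if `A` is large, many errors are visible. A trial forgives each block independently with probability
`1 / 2` and is accepted if all visible errors are forgiven. It is then accepted and correct with
probability proportional to `(k - |A|) 2 ^ (-|A|)`, and accepted and wrong with probability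
proportional to `2 |A| 2 ^ (-|A|)`. The second is at most `0.0071` times the first if
`|A| ≤ 0.0035 k`, and otherwise negligible against `exp (-k / 3200)`, hence against `α`
(`accept_wrong_le`). Since `A = ∅` has probability at least `α / 2`, an accepted trial is correct with
probability at least `1 / 1.0074` (`trial_bounds`), and among `14 / α` trials one is accepted except
with probability `exp (-7)` (`mul_sum_firstSome`).

The circuit is built in `exists_simulation`. The trials run on parallel registers of the workspace,
each with its own seed in uniform superposition, so that the state remains a product state with an
explicit formula. An entry of `X` depends on at most one entry of `M`; a simulated query computes it
with one query and erases the answer with a second one. The vector is loaded into the workspace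
at the start.
-/

-- The register types are long products, whose decidable equality exceeds the default search limits.
set_option synthInstance.maxSize 10000
set_option synthInstance.maxHeartbeats 200000

/-! ### Unitary matrices built from permutations, tensor factors and prescribed columns -/

/-- The permutation matrix of a permutation is unitary. -/
theorem permMatrix_mem_unitaryGroup {B : Type*} [Fintype B] [DecidableEq B] (σ : Equiv.Perm B) :
    σ.permMatrix ℂ ∈ Matrix.unitaryGroup B ℂ := by
  rw [Matrix.mem_unitaryGroup_iff, Matrix.star_eq_conjTranspose, Matrix.conjTranspose_permMatrix,
    ← Matrix.permMatrix_mul, inv_mul_cancel, Matrix.permMatrix_one]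

/-- The unitary `G ⊗ 1` on `B`, where `ε` splits `B` into the factor on which `G` acts and the
rest. -/
noncomputable def liftGate {B X R : Type*} [Fintype B] [DecidableEq B] [Fintype X] [DecidableEq X]
    [Fintype R] [DecidableEq R] (ε : B ≃ X × R) (G : Matrix.unitaryGroup X ℂ) :
    Matrix.unitaryGroup B ℂ :=
  ⟨(Matrix.kronecker (G : Matrix X X ℂ) (1 : Matrix R R ℂ)).submatrix ε ε, by
    have h := Matrix.kronecker_mem_unitary G.2 (one_mem (Matrix.unitaryGroup R ℂ))
    rw [Matrix.mem_unitaryGroup_iff, Matrix.star_eq_conjTranspose] at *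
    rw [Matrix.conjTranspose_submatrix, Matrix.submatrix_mul_equiv]
    erw [h]
    exact Matrix.submatrix_one_equiv ε⟩

theorem liftGate_mulVec {B X R : Type*} [Fintype B] [DecidableEq B] [Fintype X] [DecidableEq X]
    [Fintype R] [DecidableEq R] (ε : B ≃ X × R) (G : Matrix.unitaryGroup X ℂ) (ψ : B → ℂ) (b : B) :
    Matrix.mulVec (liftGate ε G : Matrix B B ℂ) ψ b =
      ∑ x, (G : Matrix X X ℂ) (ε b).1 x * ψ (ε.symm (x, (ε b).2)) := by
  rw [Matrix.mulVec, dotProduct, ← ε.symm.sum_comp, Fintype.sum_prod_type]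
  refine Finset.sum_congr rfl fun x _ => ?_
  simp [liftGate, Matrix.one_apply]

/-- The tensor power of a unitary. -/
noncomputable def tensorPowGate {Y : Type*} [Fintype Y] [DecidableEq Y] (T : ℕ)
    (G : Matrix.unitaryGroup Y ℂ) : Matrix.unitaryGroup (Fin T → Y) ℂ :=
  ⟨Matrix.of fun c c' => ∏ t, (G : Matrix Y Y ℂ) (c t) (c' t), by
    rw [Matrix.mem_unitaryGroup_iff]
    ext c c'
    have h : ∀ y y', ∑ x, (G : Matrix Y Y ℂ) y x * star ((G : Matrix Y Y ℂ) y' x) =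
        if y = y' then 1 else 0 := fun y y' => by
      have := congrFun (congrFun (Matrix.mem_unitaryGroup_iff.1 G.2) y) y'
      simpa [Matrix.mul_apply, Matrix.one_apply] using this
    simp only [Matrix.mul_apply, Matrix.star_apply, Matrix.of_apply, star_prod,
      ← Finset.prod_mul_distrib]
    rw [← Fintype.prod_sum fun t x =>
      (G : Matrix Y Y ℂ) (c t) x * star ((G : Matrix Y Y ℂ) (c' t) x)]
    simp only [h, Matrix.one_apply, Finset.prod_ite_zero, Finset.prod_const_one, Finset.mem_univ,
      true_implies, funext_iff]⟩

/-- The product state `⨂ₜ φₜ`. -/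
def prodState {Y : Type*} {T : ℕ} (φ : Fin T → Y → ℂ) : (Fin T → Y) → ℂ :=
  fun c => ∏ t, φ t (c t)

theorem tensorPowGate_mulVec {Y : Type*} [Fintype Y] [DecidableEq Y] {T : ℕ}
    (G : Matrix.unitaryGroup Y ℂ) (φ : Fin T → Y → ℂ) :
    Matrix.mulVec (tensorPowGate T G : Matrix _ _ ℂ) (prodState φ) =
      prodState fun t => Matrix.mulVec (G : Matrix Y Y ℂ) (φ t) := by
  ext c
  simp only [Matrix.mulVec, dotProduct, prodState]
  rw [Fintype.prod_sum]
  exact Finset.sum_congr rfl fun x _ => by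
    simp only [tensorPowGate, Matrix.of_apply, Finset.prod_mul_distrib]

/-- Every unit vector is the image of a given basis state under some unitary. -/
theorem exists_unitary_mulVec_single {Y : Type*} [Fintype Y] [DecidableEq Y] (y₀ : Y) (φ : Y → ℂ)
    (hφ : ∑ y, ‖φ y‖ ^ 2 = 1) :
    ∃ G : Matrix.unitaryGroup Y ℂ, Matrix.mulVec (G : Matrix Y Y ℂ) (Pi.single y₀ 1) = φ := by
  have hn : ‖WithLp.toLp 2 φ‖ = 1 := by
    rw [EuclideanSpace.norm_eq]
    simp [hφ]
  obtain ⟨b, hb⟩ := Orthonormal.exists_orthonormalBasis_extension_of_card_eq (𝕜 := ℂ)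
    (E := EuclideanSpace ℂ Y) (ι := Y) (by simp) (v := fun _ => WithLp.toLp 2 φ) (s := {y₀})
    ⟨fun _ => hn, fun i j hij => absurd (Subsingleton.elim i j) hij⟩
  refine ⟨⟨_, (EuclideanSpace.basisFun Y ℂ).toMatrix_orthonormalBasis_mem_unitary b⟩, ?_⟩
  ext y
  simp [Module.Basis.toMatrix_apply, hb y₀ rfl]

theorem sum_norm_sq_mulVec_unitary {B : Type*} [Fintype B] [DecidableEq B]
    (U : Matrix.unitaryGroup B ℂ) (ψ : B → ℂ) :
    ∑ b, ‖Matrix.mulVec (U : Matrix B B ℂ) ψ b‖ ^ 2 = ∑ b, ‖ψ b‖ ^ 2 := by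
  have key : ∀ χ : B → ℂ, ((∑ b, ‖χ b‖ ^ 2 : ℝ) : ℂ) = dotProduct (star χ) χ := fun χ => by
    simp [dotProduct, Complex.conj_mul']
  have : ((∑ b, ‖Matrix.mulVec (U : Matrix B B ℂ) ψ b‖ ^ 2 : ℝ) : ℂ) =
      ((∑ b, ‖ψ b‖ ^ 2 : ℝ) : ℂ) := by
    rw [key, key, Matrix.star_mulVec, ← Matrix.dotProduct_mulVec, Matrix.mulVec_mulVec,
      ← Matrix.star_eq_conjTranspose, Matrix.mem_unitaryGroup_iff'.1 U.2, Matrix.one_mulVec]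
  exact_mod_cast this

/-! ### States supported on the image of a register embedding -/

/-- The state on `B` obtained from a state on `X` by mapping each basis state along `e`. -/
noncomputable def pushState {X B : Type*} [Fintype X] [DecidableEq B] (e : X → B) (χ : X → ℂ) :
    B → ℂ :=
  fun b => ∑ x, if e x = b then χ x else 0

section pushState

variable {X B : Type*} [Fintype X] [DecidableEq B]

theorem pushState_comp_symm (e : X → B) (χ : X → ℂ) (π : Equiv.Perm B) :
    (fun b => pushState e χ (π.symm b)) = pushState (fun x => π (e x)) χ := by
  ext b
  simp [pushState, Equiv.eq_symm_apply]

theorem pushState_comp_perm (e : X → B) (χ : X → ℂ) (σ : Equiv.Perm X) :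
    pushState (fun x => e (σ x)) χ = pushState e (fun x => χ (σ.symm x)) := by
  ext b
  simp only [pushState]
  rw [← Equiv.sum_comp σ (fun x => if e x = b then χ (σ.symm x) else 0)]
  simp

theorem pushState_apply {e : X → B} (he : Function.Injective e) (χ : X → ℂ) (x : X) :
    pushState e χ (e x) = χ x := by
  classical
  simp [pushState, he.eq_iff]

theorem pushState_single [DecidableEq X] (e : X → B) (x : X) :
    pushState e (Pi.single x 1) = Pi.single (e x) 1 := by
  ext b
  simp only [pushState, Pi.single_apply]
  rw [Finset.sum_eq_single x] <;> simp +contextual [eq_comm]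

theorem sum_pushState [Fintype B] {e : X → B} (he : Function.Injective e) (χ : X → ℂ)
    (P : B → Prop) [DecidablePred P] :
    (∑ b, if P b then ‖pushState e χ b‖ ^ 2 else 0) = ∑ x, if P (e x) then ‖χ x‖ ^ 2 else 0 := by
  classical
  rw [← Finset.sum_subset (Finset.subset_univ (Finset.univ.image e)),
    Finset.sum_image he.injOn]
  · simp only [pushState_apply he]
  · intro b _ hb
    have h0 : pushState e χ b = 0 := Finset.sum_eq_zero fun x _ => if_neg fun h =>
      hb (by simp [← h])
    simp [h0]

theorem liftGate_mulVec_pushState [Fintype B] [DecidableEq X] {R : Type*} [Fintype R]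
    [DecidableEq R] (ε : B ≃ X × R) (G : Matrix.unitaryGroup X ℂ) (r : R) (χ : X → ℂ) :
    Matrix.mulVec (liftGate ε G : Matrix B B ℂ) (pushState (fun x => ε.symm (x, r)) χ) =
      pushState (fun x => ε.symm (x, r)) (Matrix.mulVec (G : Matrix X X ℂ) χ) := by
  ext b
  obtain ⟨⟨y, s⟩, rfl⟩ := ε.symm.surjective b
  rw [liftGate_mulVec]
  by_cases h : s = r
  · subst h
    simp [pushState, Matrix.mulVec, dotProduct]
  · have h' : ¬ r = s := fun h1 => h h1.symm
    simp [pushState, h']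

end pushState

/-! ### Runs of query algorithms and basis permutations as gates -/

section Steps

variable {p m n : ℕ} [Fact p.Prime] {W : Type} [Fintype W] [DecidableEq W]

/-- The effect of a list of steps on a vector of amplitudes. -/
noncomputable def runSteps (M : Matrix (Fin m) (Fin n) (ZMod p)) (v : Fin n → ZMod p)
    (L : List (QStep (QBasis p m n W))) (ψ : QBasis p m n W → ℂ) : QBasis p m n W → ℂ :=
  L.foldl (fun ψ s => s.apply M v ψ) ψ

theorem runSteps_append (M : Matrix (Fin m) (Fin n) (ZMod p)) (v : Fin n → ZMod p)
    (L L' : List (QStep (QBasis p m n W))) (ψ : QBasis p m n W → ℂ) :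
    runSteps M v (L ++ L') ψ = runSteps M v L' (runSteps M v L ψ) :=
  List.foldl_append

theorem runSteps_cons (M : Matrix (Fin m) (Fin n) (ZMod p)) (v : Fin n → ZMod p)
    (s : QStep (QBasis p m n W)) (L : List (QStep (QBasis p m n W))) (ψ : QBasis p m n W → ℂ) :
    runSteps M v (s :: L) ψ = runSteps M v L (s.apply M v ψ) :=
  rfl

theorem runSteps_nil (M : Matrix (Fin m) (Fin n) (ZMod p)) (v : Fin n → ZMod p)
    (ψ : QBasis p m n W → ℂ) : runSteps M v [] ψ = ψ :=
  rfl

theorem sum_norm_sq_apply (M : Matrix (Fin m) (Fin n) (ZMod p)) (v : Fin n → ZMod p)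
    (s : QStep (QBasis p m n W)) (ψ : QBasis p m n W → ℂ) :
    ∑ b, ‖s.apply M v ψ b‖ ^ 2 = ∑ b, ‖ψ b‖ ^ 2 := by
  cases s with
  | gate U => exact sum_norm_sq_mulVec_unitary U ψ
  | queryMat => exact Equiv.sum_comp (matOracle M).symm fun b => ‖ψ b‖ ^ 2
  | queryVec => exact Equiv.sum_comp (vecOracle v).symm fun b => ‖ψ b‖ ^ 2

theorem QueryAlg.sum_norm_sq_finalState (A : QueryAlg p m n) (M : Matrix (Fin m) (Fin n) (ZMod p))
    (v : Fin n → ZMod p) : ∑ b, ‖A.finalState M v b‖ ^ 2 = 1 := by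
  have h : ∀ (L : List (QStep (QBasis p m n A.W))) (ψ : QBasis p m n A.W → ℂ),
      ∑ b, ‖runSteps M v L ψ b‖ ^ 2 = ∑ b, ‖ψ b‖ ^ 2 := by
    intro L
    induction L with
    | nil => intro ψ; rfl
    | cons s L ih => intro ψ; rw [runSteps_cons, ih, sum_norm_sq_apply]
  refine (h A.steps (Pi.single A.start 1)).trans ?_
  rw [Finset.sum_eq_single A.start] <;> simp +contextual

/-- A permutation of the basis states as a step that does not query the input. -/
noncomputable def permStep (π : Equiv.Perm (QBasis p m n W)) : QStep (QBasis p m n W) :=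
  .gate ⟨_, permMatrix_mem_unitaryGroup π.symm⟩

theorem permStep_apply_pushState {X : Type*} [Fintype X] (M : Matrix (Fin m) (Fin n) (ZMod p))
    (v : Fin n → ZMod p) (π : Equiv.Perm (QBasis p m n W)) (e : X → QBasis p m n W) (χ : X → ℂ) :
    (permStep π).apply M v (pushState e χ) = pushState (fun x => π (e x)) χ := by
  rw [← pushState_comp_symm]
  exact Matrix.permMatrix_mulVec _

theorem queryMat_apply_pushState {X : Type*} [Fintype X] (M : Matrix (Fin m) (Fin n) (ZMod p))
    (v : Fin n → ZMod p) (e : X → QBasis p m n W) (χ : X → ℂ) :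
    QStep.queryMat.apply M v (pushState e χ) = pushState (fun x => matOracle M (e x)) χ :=
  pushState_comp_symm e χ (matOracle M)

theorem queryVec_apply_pushState {X : Type*} [Fintype X] (M : Matrix (Fin m) (Fin n) (ZMod p))
    (v : Fin n → ZMod p) (e : X → QBasis p m n W) (χ : X → ℂ) :
    QStep.queryVec.apply M v (pushState e χ) = pushState (fun x => vecOracle v (e x)) χ :=
  pushState_comp_symm e χ (vecOracle v)

end Steps

/-! ### Loading the vector and querying at computed addresses -/

section Macros

/-! The workspace is `(Fin n → ZMod p) × X`: a register for a copy of the vector `v`, and a register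
of arbitrary type `X`. Between the blocks of steps below, the index, answer and output registers are
back in the state `i₀, j₀, 0, 0`. -/

variable {p d n : ℕ} [Fact p.Prime] {X : Type} [Fintype X] [DecidableEq X]

/-- Exchange the address `(i₀, j₀)` with the address `f x` computed from the workspace. -/
def addrSwap (i₀ : Fin d) (j₀ : Fin n) (f : X → Fin d × Fin n) :
    Equiv.Perm (QBasis p d n ((Fin n → ZMod p) × X)) where
  toFun := fun (i, j, z, y, w, x) =>
    ((Equiv.swap (i₀, j₀) (f x) (i, j)).1, (Equiv.swap (i₀, j₀) (f x) (i, j)).2, z, y, w, x)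
  invFun := fun (i, j, z, y, w, x) =>
    ((Equiv.swap (i₀, j₀) (f x) (i, j)).1, (Equiv.swap (i₀, j₀) (f x) (i, j)).2, z, y, w, x)
  left_inv := by rintro ⟨i, j, z, y, w, x⟩; simp
  right_inv := by rintro ⟨i, j, z, y, w, x⟩; simp

/-- Exchange the answer register with the `j`-th entry of the vector register. -/
def loadSwap (j : Fin n) : Equiv.Perm (QBasis p d n ((Fin n → ZMod p) × X)) where
  toFun := fun (i, j', z, y, w, x) => (i, j', w j, y, Function.update w j z, x)
  invFun := fun (i, j', z, y, w, x) => (i, j', w j, y, Function.update w j z, x)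
  left_inv := by rintro ⟨i, j', z, y, w, x⟩; simp
  right_inv := by rintro ⟨i, j', z, y, w, x⟩; simp

/-- Apply the permutation `τ z` to `X`, where `z` is the content of the answer register, and negate
the answer register. The negation makes a second query erase the answer. -/
def answerPerm (τ : ZMod p → Equiv.Perm X) :
    Equiv.Perm (QBasis p d n ((Fin n → ZMod p) × X)) where
  toFun := fun (i, j, z, y, w, x) => (i, j, -z, y, w, τ z x)
  invFun := fun (i, j, z, y, w, x) => (i, j, -z, y, w, (τ (-z)).symm x)
  left_inv := by rintro ⟨i, j, z, y, w, x⟩; simp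
  right_inv := by rintro ⟨i, j, z, y, w, x⟩; simp

/-- Apply to `X` a permutation that depends on the vector register. -/
def workPerm (τ : (Fin n → ZMod p) → Equiv.Perm X) :
    Equiv.Perm (QBasis p d n ((Fin n → ZMod p) × X)) where
  toFun := fun (i, j, z, y, w, x) => (i, j, z, y, w, τ w x)
  invFun := fun (i, j, z, y, w, x) => (i, j, z, y, w, (τ w).symm x)
  left_inv := by rintro ⟨i, j, z, y, w, x⟩; simp
  right_inv := by rintro ⟨i, j, z, y, w, x⟩; simp

/-- Add a function of the workspace to the output register. -/
def outputPerm (F : (Fin n → ZMod p) → X → Fin d → ZMod p) :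
    Equiv.Perm (QBasis p d n ((Fin n → ZMod p) × X)) where
  toFun := fun (i, j, z, y, w, x) => (i, j, z, y + F w x, w, x)
  invFun := fun (i, j, z, y, w, x) => (i, j, z, y - F w x, w, x)
  left_inv := by rintro ⟨i, j, z, y, w, x⟩; simp
  right_inv := by rintro ⟨i, j, z, y, w, x⟩; simp

/-- Read the `j`-th entry of the vector into the vector register. -/
noncomputable def loadSteps (i₀ : Fin d) (j₀ j : Fin n) :
    List (QStep (QBasis p d n ((Fin n → ZMod p) × X))) :=
  [permStep (addrSwap i₀ j₀ fun _ => (i₀, j)), .queryVec, permStep (loadSwap j),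
    permStep (addrSwap i₀ j₀ fun _ => (i₀, j))]

theorem runSteps_loadSteps (M : Matrix (Fin d) (Fin n) (ZMod p)) (v w : Fin n → ZMod p)
    (i₀ : Fin d) (j₀ j : Fin n) (hw : w j = 0) (χ : X → ℂ) :
    runSteps M v (loadSteps i₀ j₀ j) (pushState (fun x => (i₀, j₀, 0, 0, w, x)) χ) =
      pushState (fun x => (i₀, j₀, 0, 0, Function.update w j (v j), x)) χ := by
  simp [runSteps, loadSteps, permStep_apply_pushState, queryVec_apply_pushState, addrSwap, vecOracle,
    loadSwap, hw]

theorem runSteps_flatMap_loadSteps (M : Matrix (Fin d) (Fin n) (ZMod p)) (v : Fin n → ZMod p)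
    (i₀ : Fin d) (j₀ : Fin n) (χ : X → ℂ) :
    runSteps M v ((List.finRange n).flatMap (loadSteps i₀ j₀))
      (pushState (fun x => (i₀, j₀, 0, 0, 0, x)) χ) =
      pushState (fun x => (i₀, j₀, 0, 0, v, x)) χ := by
  have h : ∀ (l : List (Fin n)) (w : Fin n → ZMod p), l.Nodup → (∀ j ∈ l, w j = 0) →
      runSteps M v (l.flatMap (loadSteps i₀ j₀)) (pushState (fun x => (i₀, j₀, 0, 0, w, x)) χ) =
        pushState (fun x => (i₀, j₀, 0, 0, (fun j => if j ∈ l then v j else w j), x)) χ := by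
    intro l
    induction l with
    | nil => intro w _ _; simp [runSteps_nil]
    | cons a l ih =>
      intro w hl hw
      rw [List.nodup_cons] at hl
      rw [List.flatMap_cons, runSteps_append,
        runSteps_loadSteps M v w i₀ j₀ a (hw a List.mem_cons_self), ih _ hl.2]
      · have : (fun j => if j ∈ l then v j else Function.update w a (v a) j) =
            fun j => if j ∈ a :: l then v j else w j := by
          funext j
          by_cases hj : j = a
          · subst hj; simp [hl.1]
          · simp [hj]
        rw [this]
      · intro j hj
        rw [Function.update_of_ne (ne_of_mem_of_not_mem hj hl.1), hw j (List.mem_cons_of_mem _ hj)]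
  simpa using h (List.finRange n) 0 (List.nodup_finRange n) fun _ _ => rfl

/-- Query the matrix at the address `f x`, apply `τ a` to `X`, where `a` is the answer, and erase the
answer with a second query. -/
noncomputable def controlledSteps (i₀ : Fin d) (j₀ : Fin n) (f : X → Fin d × Fin n)
    (τ : ZMod p → Equiv.Perm X) : List (QStep (QBasis p d n ((Fin n → ZMod p) × X))) :=
  [permStep (addrSwap i₀ j₀ f), .queryMat, permStep (answerPerm τ), .queryMat,
    permStep (addrSwap i₀ j₀ f)]

theorem runSteps_controlledSteps (M : Matrix (Fin d) (Fin n) (ZMod p)) (v w : Fin n → ZMod p)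
    (i₀ : Fin d) (j₀ : Fin n) (f : X → Fin d × Fin n) (τ : ZMod p → Equiv.Perm X)
    (hf : ∀ a x, f (τ a x) = f x) (σ : Equiv.Perm X)
    (hσ : ∀ x, σ x = τ (M (f x).1 (f x).2) x) (χ : X → ℂ) :
    runSteps M v (controlledSteps i₀ j₀ f τ) (pushState (fun x => (i₀, j₀, 0, 0, w, x)) χ) =
      pushState (fun x => (i₀, j₀, 0, 0, w, x)) (fun x => χ (σ.symm x)) := by
  rw [← pushState_comp_perm]
  simp [runSteps, controlledSteps, permStep_apply_pushState, queryMat_apply_pushState, addrSwap,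
    matOracle, answerPerm, hf, hσ]

theorem countP_controlledSteps (i₀ : Fin d) (j₀ : Fin n) (f : X → Fin d × Fin n)
    (τ : ZMod p → Equiv.Perm X) :
    (controlledSteps i₀ j₀ f τ).countP QStep.isQueryMat = 2 :=
  rfl

/-- The split of the basis states into the register `X` and the other registers. -/
def workEquiv : QBasis p d n ((Fin n → ZMod p) × X) ≃
    X × (Fin d × Fin n × ZMod p × (Fin d → ZMod p) × (Fin n → ZMod p)) where
  toFun := fun (i, j, z, y, w, x) => (x, i, j, z, y, w)
  invFun := fun (x, i, j, z, y, w) => (i, j, z, y, w, x)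
  left_inv _ := rfl
  right_inv _ := rfl

theorem gate_workEquiv_apply_pushState (M : Matrix (Fin d) (Fin n) (ZMod p)) (v w : Fin n → ZMod p)
    (i₀ : Fin d) (j₀ : Fin n) (G : Matrix.unitaryGroup X ℂ) (χ : X → ℂ) :
    (QStep.gate (liftGate workEquiv G)).apply M v (pushState (fun x => (i₀, j₀, 0, 0, w, x)) χ) =
      pushState (fun x => (i₀, j₀, 0, 0, w, x)) (Matrix.mulVec (G : Matrix X X ℂ) χ) :=
  liftGate_mulVec_pushState workEquiv G (i₀, j₀, 0, 0, w) χ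

end Macros

/-! ### Simulating independent runs on matrices computed from the input -/

section Simulation

variable {p d n : ℕ} [Fact p.Prime] {S W : Type} [Fintype S] [DecidableEq S] [Fintype W]
  [DecidableEq W]

/-- The matrix oracle of `plant s K`, controlled on a seed `s`. -/
def plantPerm (plant : S → Matrix (Fin d) (Fin n) (ZMod p) → Matrix (Fin n) (Fin n) (ZMod p))
    (K : Matrix (Fin d) (Fin n) (ZMod p)) : Equiv.Perm (S × QBasis p n n W) :=
  Equiv.prodShear (Equiv.refl S) fun s => matOracle (plant s K)

/-- A permutation applied to the `t`-th of `T` registers. -/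
def copyPerm {Y : Type*} {T : ℕ} (t : Fin T) (σ : Equiv.Perm Y) : Equiv.Perm (Fin T → Y) :=
  Equiv.piCongrRight fun t' => if t' = t then σ else 1

theorem prodState_copyPerm_symm {Y : Type*} {T : ℕ} (t : Fin T) (σ : Equiv.Perm Y)
    (φ : Fin T → Y → ℂ) :
    (fun c => prodState φ ((copyPerm t σ).symm c)) =
      prodState fun t' => if t' = t then fun y => φ t' (σ.symm y) else φ t' := by
  funext c
  refine Finset.prod_congr rfl fun t' _ => ?_
  by_cases h : t' = t
  · simp [copyPerm, h]
  · simp only [copyPerm, h, if_false, Equiv.piCongrRight_symm_apply, Pi.map_apply]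
    rfl

/-- The steps that simulate one step of an algorithm on `T` registers in parallel, where the register
with seed `s` sees the matrix `plant s M`. The entry `i, j` of `plant s M` depends on `M` only
through the entry at `addr s i j`. -/
noncomputable def simStep (i₀ : Fin d) (j₀ : Fin n) (T : ℕ)
    (plant : S → Matrix (Fin d) (Fin n) (ZMod p) → Matrix (Fin n) (Fin n) (ZMod p))
    (addr : S → Fin n → Fin n → Fin d × Fin n) :
    QStep (QBasis p n n W) →
      List (QStep (QBasis p d n ((Fin n → ZMod p) × (Fin T → S × QBasis p n n W))))
  | .gate U => [.gate (liftGate workEquiv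
      (tensorPowGate T (liftGate (Equiv.prodComm S (QBasis p n n W)) U)))]
  | .queryMat => (List.finRange T).flatMap fun t =>
      controlledSteps i₀ j₀ (fun c => addr (c t).1 (c t).2.1 (c t).2.2.1)
        fun a => copyPerm t (plantPerm plant fun _ _ => a)
  | .queryVec => [permStep (workPerm fun w =>
      Equiv.piCongrRight fun _ => Equiv.prodShear (Equiv.refl S) fun _ => vecOracle w)]

theorem countP_simStep (i₀ : Fin d) (j₀ : Fin n) (T : ℕ)
    (plant : S → Matrix (Fin d) (Fin n) (ZMod p) → Matrix (Fin n) (Fin n) (ZMod p))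
    (addr : S → Fin n → Fin n → Fin d × Fin n) (s : QStep (QBasis p n n W)) :
    (simStep i₀ j₀ T plant addr s).countP QStep.isQueryMat =
      2 * T * if s.isQueryMat then 1 else 0 := by
  cases s with
  | gate U => rfl
  | queryVec => rfl
  | queryMat =>
    simp [simStep, List.countP_flatMap, Function.comp_def, countP_controlledSteps,
      QStep.isQueryMat, mul_comm]

theorem runSteps_simStep (i₀ : Fin d) (j₀ : Fin n) (T : ℕ)
    (plant : S → Matrix (Fin d) (Fin n) (ZMod p) → Matrix (Fin n) (Fin n) (ZMod p))
    (addr : S → Fin n → Fin n → Fin d × Fin n)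
    (hloc : ∀ s K i j, plant s K i j =
      plant s (fun _ _ => K (addr s i j).1 (addr s i j).2) i j)
    (M : Matrix (Fin d) (Fin n) (ZMod p)) (v : Fin n → ZMod p) (κ : ℂ)
    (ψ : S → QBasis p n n W → ℂ) (s : QStep (QBasis p n n W)) :
    runSteps M v (simStep i₀ j₀ T plant addr s)
      (pushState (fun c => (i₀, j₀, 0, 0, v, c)) (prodState fun _ y => κ * ψ y.1 y.2)) =
    pushState (fun c => (i₀, j₀, 0, 0, v, c))
      (prodState fun _ y => κ * s.apply (plant y.1 M) v (ψ y.1) y.2) := by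
  cases s with
  | gate U =>
    rw [simStep, runSteps_cons, runSteps_nil, gate_workEquiv_apply_pushState, tensorPowGate_mulVec]
    congr 2
    funext _ y
    rw [liftGate_mulVec, QStep.apply, Matrix.mulVec, dotProduct, Finset.mul_sum]
    refine Finset.sum_congr rfl fun b _ => ?_
    simp only [Equiv.prodComm_apply, Equiv.prodComm_symm, Prod.swap]
    ring
  | queryVec =>
    rw [simStep, runSteps_cons, runSteps_nil, permStep_apply_pushState]
    exact pushState_comp_perm
      (fun c : Fin T → S × QBasis p n n W =>
        ((i₀, j₀, 0, 0, v, c) : QBasis p d n ((Fin n → ZMod p) × (Fin T → S × QBasis p n n W)))) _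
      (Equiv.piCongrRight fun _ => Equiv.prodShear (Equiv.refl S) fun _ => vecOracle v)
  | queryMat =>
    have h : ∀ (l : List (Fin T)) (φ : Fin T → S × QBasis p n n W → ℂ), l.Nodup →
        runSteps M v (l.flatMap fun t =>
          controlledSteps i₀ j₀ (fun c => addr (c t).1 (c t).2.1 (c t).2.2.1)
            fun a => copyPerm t (plantPerm plant fun _ _ => a))
          (pushState (fun c => (i₀, j₀, 0, 0, v, c)) (prodState φ)) =
        pushState (fun c => (i₀, j₀, 0, 0, v, c)) (prodState fun t =>
          if t ∈ l then fun y => φ t ((plantPerm plant M).symm y) else φ t) := by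
      intro l
      induction l with
      | nil => intro φ _; simp [runSteps_nil]
      | cons t l ih =>
        intro φ hl
        rw [List.nodup_cons] at hl
        rw [List.flatMap_cons, runSteps_append,
          runSteps_controlledSteps M v v i₀ j₀ _ _ _ (copyPerm t (plantPerm plant M)),
          prodState_copyPerm_symm, ih _ hl.2]
        · congr 2
          funext t'
          by_cases ht : t' = t
          · subst ht; simp [hl.1]
          · simp [ht]
        · intro c
          funext t'
          by_cases ht : t' = t
          · subst ht
            rcases hc : c t' with ⟨s, i, j, z, y, w⟩
            simpa [copyPerm, plantPerm, matOracle, hc] using hloc s M i j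
          · simp [copyPerm, ht]
        · intro a c
          simp [copyPerm, plantPerm, matOracle]
    rw [simStep, h _ _ (List.nodup_finRange T)]
    simp only [List.mem_finRange, if_true]
    rfl

theorem runSteps_flatMap_simStep (i₀ : Fin d) (j₀ : Fin n) (T : ℕ)
    (plant : S → Matrix (Fin d) (Fin n) (ZMod p) → Matrix (Fin n) (Fin n) (ZMod p))
    (addr : S → Fin n → Fin n → Fin d × Fin n)
    (hloc : ∀ s K i j, plant s K i j =
      plant s (fun _ _ => K (addr s i j).1 (addr s i j).2) i j)
    (M : Matrix (Fin d) (Fin n) (ZMod p)) (v : Fin n → ZMod p) (κ : ℂ)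
    (L : List (QStep (QBasis p n n W))) (ψ : S → QBasis p n n W → ℂ) :
    runSteps M v (L.flatMap (simStep i₀ j₀ T plant addr))
      (pushState (fun c => (i₀, j₀, 0, 0, v, c)) (prodState fun _ y => κ * ψ y.1 y.2)) =
    pushState (fun c => (i₀, j₀, 0, 0, v, c))
      (prodState fun _ y => κ * runSteps (plant y.1 M) v L (ψ y.1) y.2) := by
  induction L generalizing ψ with
  | nil => rfl
  | cons s L ih =>
    rw [List.flatMap_cons, runSteps_append, runSteps_simStep i₀ j₀ T plant addr hloc]
    exact ih fun r => s.apply (plant r M) v (ψ r)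

/-- From an algorithm `A` on `n × n` matrices and matrices `plant s M` each of whose entries depends
on one entry of `M`, one obtains an algorithm on `d × n` matrices whose output is distributed as
`F v c`, where `c` consists of `T` independent samples of a uniform seed `s` together with the
measured final state of `A` on `plant s M`. Each simulated query takes two queries, to compute the
answer and to erase it. -/
theorem exists_simulation (hd : 0 < d) (hn : 0 < n) [Nonempty S] (A : QueryAlg p n n) (T : ℕ)
    (plant : S → Matrix (Fin d) (Fin n) (ZMod p) → Matrix (Fin n) (Fin n) (ZMod p))
    (addr : S → Fin n → Fin n → Fin d × Fin n)
    (hloc : ∀ s K i j, plant s K i j =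
      plant s (fun _ _ => K (addr s i j).1 (addr s i j).2) i j)
    (F : (Fin n → ZMod p) → (Fin T → S × QBasis p n n A.W) → Fin d → ZMod p) :
    ∃ A₁ : QueryAlg p d n, A₁.matQueries = 2 * T * A.matQueries ∧
      ∀ M v y, A₁.outputProb M v y = ∑ c : Fin T → S × QBasis p n n A.W,
        if F v c = y then
          ∏ t, ‖A.finalState (plant (c t).1 M) v (c t).2‖ ^ 2 / (Fintype.card S : ℝ)
        else 0 := by
  have hS : (0 : ℝ) < Fintype.card S := by exact_mod_cast Fintype.card_pos
  obtain ⟨s₀⟩ := ‹Nonempty S›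
  set κ : ℂ := (((Real.sqrt (Fintype.card S))⁻¹ : ℝ) : ℂ) with hκ
  have hκ2 : ‖κ‖ ^ 2 = (Fintype.card S : ℝ)⁻¹ := by
    rw [hκ, Complex.norm_real, Real.norm_eq_abs, sq_abs, inv_pow, Real.sq_sqrt hS.le]
  let φ₀ : S × QBasis p n n A.W → ℂ := fun y => κ * Pi.single (M := fun _ => ℂ) A.start 1 y.2
  obtain ⟨G, hG⟩ := exists_unitary_mulVec_single (s₀, A.start) φ₀ (by
    have h1 : ∀ b, ‖(Pi.single A.start 1 : QBasis p n n A.W → ℂ) b‖ ^ 2 =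
        if b = A.start then 1 else 0 := fun b => by
      by_cases h : b = A.start
      · subst h; simp
      · simp [h]
    simp only [φ₀, norm_mul, mul_pow, hκ2, h1]
    rw [Fintype.sum_prod_type]
    simp [hS.ne'])
  let i₀ : Fin d := ⟨0, hd⟩
  let j₀ : Fin n := ⟨0, hn⟩
  let L₀ : List (QStep (QBasis p d n ((Fin n → ZMod p) × (Fin T → S × QBasis p n n A.W)))) :=
    [.gate (liftGate workEquiv (tensorPowGate T G))]
  let A₁ : QueryAlg p d n :=
    { W := (Fin n → ZMod p) × (Fin T → S × QBasis p n n A.W)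
      start := (i₀, j₀, 0, 0, 0, fun _ => (s₀, A.start))
      steps := L₀ ++ (List.finRange n).flatMap (loadSteps i₀ j₀) ++
        A.steps.flatMap (simStep i₀ j₀ T plant addr) ++ [permStep (outputPerm F)] }
  have hfin : ∀ M v, A₁.finalState M v =
      pushState (fun c => (i₀, j₀, 0, F v c, v, c))
        (prodState fun _ y => κ * A.finalState (plant y.1 M) v y.2) := by
    intro M v
    change runSteps M v (L₀ ++ _ ++ _ ++ _)
      (Pi.single (i₀, j₀, 0, 0, 0, fun _ => (s₀, A.start)) 1) = _
    have hprod : (Pi.single (fun _ => (s₀, A.start)) 1 : (Fin T → S × QBasis p n n A.W) → ℂ) =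
        prodState fun _ => Pi.single (s₀, A.start) 1 := by
      funext c
      simp [prodState, Pi.single_apply, Finset.prod_ite_zero, funext_iff]
    rw [runSteps_append, runSteps_append, runSteps_append,
      ← pushState_single (fun c => (i₀, j₀, 0, 0, 0, c))]
    simp only [L₀, runSteps_cons, runSteps_nil]
    rw [gate_workEquiv_apply_pushState, hprod, tensorPowGate_mulVec, hG, runSteps_flatMap_loadSteps,
      runSteps_flatMap_simStep i₀ j₀ T plant addr hloc M v κ A.steps
        (fun _ => Pi.single A.start 1),
      permStep_apply_pushState]
    simp only [outputPerm, Equiv.coe_fn_mk, zero_add]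
    rfl
  refine ⟨A₁, ?_, fun M v y => ?_⟩
  · have hcount : ∀ L : List (QStep (QBasis p n n A.W)),
        (L.flatMap (simStep i₀ j₀ T plant addr)).countP QStep.isQueryMat =
          2 * T * L.countP QStep.isQueryMat := by
      intro L
      induction L with
      | nil => rfl
      | cons s L ih =>
        rw [List.flatMap_cons, List.countP_append, ih, countP_simStep, List.countP_cons]
        ring
    change List.countP _ (L₀ ++ _ ++ _ ++ _) = _
    rw [List.countP_append, List.countP_append, List.countP_append, hcount, List.countP_flatMap]
    have hload : ((List.finRange n).map (List.countP QStep.isQueryMat ∘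
        loadSteps (p := p) (X := Fin T → S × QBasis p n n A.W) i₀ j₀)).sum = 0 :=
      List.sum_eq_zero fun x hx => by
        obtain ⟨j, _, rfl⟩ := List.mem_map.1 hx
        rfl
    rw [hload]
    simp [L₀, QStep.isQueryMat, permStep, QueryAlg.matQueries]
  · rw [QueryAlg.outputProb, hfin]
    refine (sum_pushState (fun c c' h => ?_) _ (fun b : QBasis p d n A₁.W => b.2.2.2.1 = y)).trans ?_
    · simpa using congrArg (fun b : QBasis p d n A₁.W => b.2.2.2.2.2) h
    · refine Finset.sum_congr rfl fun c _ => ?_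
      congr 1
      rw [prodState, norm_prod, ← Finset.prod_pow]
      refine Finset.prod_congr rfl fun t _ => ?_
      rw [norm_mul, mul_pow, hκ2, div_eq_inv_mul]

end Simulation

/-! ### Repeating a trial until it is accepted -/

/-- The outcome of the first accepted one among `T` trials. -/
def firstSome {β : Type*} {T : ℕ} (f : Fin T → Option β) : Option β :=
  (List.ofFn f).findSome? id

theorem firstSome_cons {β : Type*} {T : ℕ} (o : Option β) (f : Fin T → Option β) :
    firstSome (Fin.cons o f : Fin (T + 1) → Option β) = o.or (firstSome f) := by
  cases o <;> simp [firstSome, List.ofFn_succ]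

/-- If a trial yields `b` with probability `g` and is accepted with probability `a`, the first
accepted one among `T` independent trials yields `b` with probability `g / a * (1 - (1 - a) ^ T)`. -/
theorem mul_sum_firstSome {Y β : Type*} [Fintype Y] [DecidableEq β] (q : Y → ℝ)
    (hq : ∑ y, q y = 1) (dec : Y → Option β) (b : β) (T : ℕ) :
    (∑ y, if dec y ≠ none then q y else 0) *
      (∑ c : Fin T → Y, if firstSome (fun t => dec (c t)) = some b then ∏ t, q (c t) else 0) =
    (∑ y, if dec y = some b then q y else 0) *
      (1 - (1 - ∑ y, if dec y ≠ none then q y else 0) ^ T) := by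
  set a := ∑ y, if dec y ≠ none then q y else 0 with ha
  set g := ∑ y, if dec y = some b then q y else 0 with hg
  have hrej : 1 - a = ∑ y, if dec y = none then q y else 0 := by
    rw [← hq, ha, ← Finset.sum_sub_distrib]
    refine Finset.sum_congr rfl fun y _ => ?_
    by_cases h : dec y = none <;> simp [h]
  induction T with
  | zero => simp [firstSome]
  | succ T ih =>
    have hstep : (∑ c : Fin (T + 1) → Y,
        if firstSome (fun t => dec (c t)) = some b then ∏ t, q (c t) else 0) =
        g + (1 - a) * ∑ c : Fin T → Y,
          if firstSome (fun t => dec (c t)) = some b then ∏ t, q (c t) else 0 := by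
      rw [← (Fin.consEquiv fun _ => Y).sum_comp, Fintype.sum_prod_type, hrej, hg, Finset.sum_mul,
        ← Finset.sum_add_distrib]
      refine Finset.sum_congr rfl fun y _ => ?_
      have hcons : ∀ c : Fin T → Y, (fun t => dec ((Fin.consEquiv fun _ => Y) (y, c) t)) =
          (Fin.cons (dec y) fun t => dec (c t) : Fin (T + 1) → Option β) := fun c => by
        funext t
        refine Fin.cases ?_ (fun t => ?_) t <;> simp [Fin.consEquiv]
      have htot : ∑ c : Fin T → Y, ∏ t, q (c t) = 1 := by
        rw [← Fintype.prod_sum fun _ => q]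
        simp [hq]
      simp only [hcons, firstSome_cons, Fin.prod_univ_succ]
      simp only [Fin.consEquiv, Equiv.coe_fn_mk, Fin.cons_zero, Fin.cons_succ]
      cases hy : dec y with
      | none =>
        simp only [Option.none_or, if_true, reduceCtorEq, if_false, zero_add, Finset.mul_sum,
          mul_ite, mul_zero]
        congr!
      | some b' =>
        by_cases hb : b' = b
        · simp [hb, ← Finset.mul_sum, htot]
        · simp [hb]
    rw [hstep, mul_add, mul_left_comm, ih]
    ring

/-! ### Accepting with a weight that halves with each visible error -/

/-- A pattern `u` forgives the errors in the blocks `b` with `u b = true`. Each error in `A` halves the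
number of patterns that forgive all of `A`. -/
theorem card_filter_forall_mem {k : ℕ} (A : Finset (Fin k)) :
    ((Finset.univ.filter fun u : Fin k → Bool => ∀ b ∈ A, u b = true).card : ℝ) =
      2 ^ k * (1 / 2) ^ A.card := by
  have h : (Finset.univ.filter fun u : Fin k → Bool => ∀ b ∈ A, u b = true) =
      Fintype.piFinset fun b => if b ∈ A then {true} else Finset.univ := by
    ext u
    simp only [Finset.mem_filter, Finset.mem_univ, true_and, Fintype.mem_piFinset]
    refine forall_congr' fun b => ?_
    by_cases hb : b ∈ A <;> simp [hb]
  have hc : (Fintype.piFinset fun b => if b ∈ A then {true} else Finset.univ :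
      Finset (Fin k → Bool)).card * 2 ^ A.card = 2 ^ k := by
    rw [Fintype.card_piFinset]
    have : ∏ b : Fin k, (if b ∈ A then ({true} : Finset Bool) else Finset.univ).card =
        2 ^ Aᶜ.card := by
      rw [← Finset.prod_const, ← Finset.prod_compl_mul_prod A]
      rw [Finset.prod_congr rfl (fun b hb => by rw [if_neg (Finset.mem_compl.1 hb)]),
        Finset.prod_eq_one (s := A) (fun b hb => by rw [if_pos hb]; rfl)]
      simp
    rw [this, ← pow_add, Finset.card_compl_add_card, Fintype.card_fin]
  have hr : ((Fintype.piFinset fun b => if b ∈ A then {true} else Finset.univ :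
      Finset (Fin k → Bool)).card : ℝ) * 2 ^ A.card = 2 ^ k := by exact_mod_cast hc
  rw [h, ← hr, mul_assoc, ← mul_pow]
  norm_num

/-- The number of choices of `I` and `u` for which block `I` is correct and `u` forgives all errors,
when `A` is the set of wrong blocks. -/
theorem sum_accept_correct {k : ℕ} (A : Finset (Fin k)) :
    (∑ I : Fin k, ∑ u : Fin k → Bool,
      if (∀ b, b ≠ I → b ∈ A → u b = true) ∧ I ∉ A then (1 : ℝ) else 0) =
      ((k : ℝ) - A.card) * (2 ^ k * (1 / 2) ^ A.card) := by
  have h : ∀ I : Fin k, (∑ u : Fin k → Bool,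
      if (∀ b, b ≠ I → b ∈ A → u b = true) ∧ I ∉ A then (1 : ℝ) else 0) =
      if I ∈ Aᶜ then 2 ^ k * (1 / 2) ^ A.card else 0 := by
    intro I
    by_cases hI : I ∈ A
    · simp [hI]
    · rw [if_pos (Finset.mem_compl.2 hI), ← card_filter_forall_mem, Finset.sum_boole]
      congr 2
      ext u
      simp only [hI, not_false_eq_true, and_true, Finset.mem_filter, Finset.mem_univ, true_and]
      exact ⟨fun h b hb => h b (ne_of_mem_of_not_mem hb hI) hb, fun h b _ hb => h b hb⟩
  simp only [h]
  rw [Finset.sum_ite_mem, Finset.univ_inter, Finset.sum_const, nsmul_eq_mul, Finset.card_compl,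
    Fintype.card_fin, Nat.cast_sub (by simpa using A.card_le_univ)]

/-- The number of choices of `I` and `u` for which block `I` is wrong and `u` forgives all other
errors. An error inside block `I` is invisible, which costs a factor `2`. -/
theorem sum_accept_wrong {k : ℕ} (A : Finset (Fin k)) :
    (∑ I : Fin k, ∑ u : Fin k → Bool,
      if (∀ b, b ≠ I → b ∈ A → u b = true) ∧ I ∈ A then (1 : ℝ) else 0) =
      (A.card : ℝ) * (2 * (2 ^ k * (1 / 2) ^ A.card)) := by
  have h : ∀ I : Fin k, (∑ u : Fin k → Bool,
      if (∀ b, b ≠ I → b ∈ A → u b = true) ∧ I ∈ A then (1 : ℝ) else 0) =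
      if I ∈ A then 2 * (2 ^ k * (1 / 2) ^ A.card) else 0 := by
    intro I
    by_cases hI : I ∈ A
    · have hc : (2 : ℝ) * (2 ^ k * (1 / 2) ^ A.card) = 2 ^ k * (1 / 2) ^ (A.erase I).card := by
        rw [← Finset.card_erase_add_one hI, pow_succ]
        ring
      rw [if_pos hI, hc, ← card_filter_forall_mem, Finset.sum_boole]
      congr 2
      ext u
      simp [hI]
    · simp [hI]
  simp only [h]
  rw [Finset.sum_ite_mem, Finset.univ_inter, Finset.sum_const, nsmul_eq_mul]

/-- The numerical heart of the argument. With at most `0.0035 k` wrong blocks, a random block is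
wrong with small conditional probability; with more, acceptance is much less likely than
`exp (-k / 3200)`. -/
theorem accept_wrong_le {k : ℕ} {α : ℝ} (hα : α ≤ 1)
    (hk : 4 * Real.exp (-(k : ℝ) / 3200) ≤ α) (A : Finset (Fin k)) :
    (A.card : ℝ) * (2 * (2 ^ k * (1 / 2) ^ A.card)) ≤
      0.0071 * (((k : ℝ) - A.card) * (2 ^ k * (1 / 2) ^ A.card)) +
        0.0003 * (α / 2) * (k * 2 ^ k) := by
  have hAk : (A.card : ℝ) ≤ k := by exact_mod_cast (by simpa using A.card_le_univ)
  have hE := Real.exp_pos (-(k : ℝ) / 3200)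
  have hα0 : 0 < α := by linarith
  have h2k : (0 : ℝ) < 2 ^ k := by positivity
  set r : ℝ := (A.card : ℝ) with hr
  have hx : (0 : ℝ) < (1 / 2) ^ A.card := by positivity
  set x : ℝ := (1 / 2) ^ A.card with hx'
  by_cases hsmall : r ≤ 0.0035 * k
  · have h1 : 0 ≤ (0.0071 * (k - r) - 2 * r) * (2 ^ k * x) :=
      mul_nonneg (by linarith) (by positivity)
    have h2 : 0 ≤ 0.0003 * (α / 2) * (k * 2 ^ k) := by positivity
    linarith
  · rw [not_le] at hsmall
    have hlog := Real.log_two_gt_d9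
    have hkbig : 4435 ≤ (k : ℝ) := by
      have h4 : Real.exp (-(k : ℝ) / 3200) ≤ 1 / 4 := by linarith
      have h5 : Real.log 2 + Real.log 2 = Real.log 4 := by
        rw [← Real.log_mul (by norm_num) (by norm_num)]; norm_num
      have h6 : -(k : ℝ) / 3200 ≤ Real.log (1 / 4) := by
        rw [← Real.log_exp (-(k : ℝ) / 3200)]; exact Real.log_le_log hE h4
      rw [one_div, Real.log_inv] at h6
      linarith
    have hxexp : x = Real.exp (-(r * Real.log 2)) := by
      rw [hx', one_div, inv_pow, Real.exp_neg, mul_comm, ← Real.rpow_def_of_pos (by norm_num), hr,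
        Real.rpow_natCast]
    have h9 : Real.exp (-9) ≤ 0.0003 := by
      have h := Real.exp_one_gt_d9
      have h' : (2.7 : ℝ) ^ 9 ≤ Real.exp 1 ^ 9 := by gcongr; linarith
      rw [← Real.exp_nat_mul] at h'
      norm_num at h'
      rw [Real.exp_neg]
      refine inv_le_of_inv_le₀ (by norm_num) (le_trans ?_ h')
      norm_num
    have hxs : x ≤ 0.0003 * Real.exp (-(k : ℝ) / 3200) := by
      rw [hxexp]
      refine le_trans ?_ (mul_le_mul_of_nonneg_right h9 hE.le)
      rw [← Real.exp_add, Real.exp_le_exp]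
      nlinarith
    have h1 : r * (2 * (2 ^ k * x)) ≤ k * (2 * (2 ^ k * x)) := by gcongr
    have h2 : 2 * x ≤ 0.0003 * (α / 2) := by linarith
    have h3 : 0 ≤ 0.0071 * ((k - r) * (2 ^ k * x)) := by
      have : 0 ≤ k - r := by linarith
      positivity
    have h4 : k * 2 ^ k * (2 * x) ≤ k * 2 ^ k * (0.0003 * (α / 2)) := by gcongr
    linarith

/-! ### Planting the input in a random block of rows -/

section Planting

variable {p k d n : ℕ}

/-- The matrix with `k` blocks of `d` rows each whose block `I` is `K` and whose other blocks are
zero. -/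
def plantBlock (I : Fin k) (K : Matrix (Fin d) (Fin n) (ZMod p)) :
    Matrix (Fin (k * d)) (Fin n) (ZMod p) :=
  Matrix.of fun i j =>
    if (finProdFinEquiv.symm i).1 = I then K (finProdFinEquiv.symm i).2 j else 0

/-- The block `b` of a vector that consists of `k` blocks of length `d`. -/
def rowBlock (b : Fin k) (y : Fin (k * d) → ZMod p) : Fin d → ZMod p :=
  fun r => y (finProdFinEquiv (b, r))

theorem rowBlock_mulVec_plantBlock (I b : Fin k) (N : Matrix (Fin (k * d)) (Fin n) (ZMod p))
    (K : Matrix (Fin d) (Fin n) (ZMod p)) (v : Fin n → ZMod p) :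
    rowBlock b ((N + plantBlock I K).mulVec v) =
      rowBlock b (N.mulVec v) + if b = I then K.mulVec v else 0 := by
  have hK : ∀ r j, plantBlock I K (finProdFinEquiv (b, r)) j = if b = I then K r j else 0 :=
    fun r j => by rw [plantBlock, Matrix.of_apply, Equiv.symm_apply_apply]
  ext r
  by_cases h : b = I
  · subst h
    simp [rowBlock, Matrix.mulVec, dotProduct, hK, add_mul, Finset.sum_add_distrib]
  · simp [rowBlock, Matrix.mulVec, dotProduct, hK, h]

/-- The blocks in which `y` differs from `X v`. -/
def wrongBlocks (X : Matrix (Fin (k * d)) (Fin n) (ZMod p)) (v : Fin n → ZMod p)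
    (y : Fin (k * d) → ZMod p) : Finset (Fin k) :=
  Finset.univ.filter fun b => rowBlock b y ≠ rowBlock b (X.mulVec v)

theorem mem_wrongBlocks {X : Matrix (Fin (k * d)) (Fin n) (ZMod p)} {v : Fin n → ZMod p}
    {y : Fin (k * d) → ZMod p} {b : Fin k} :
    b ∈ wrongBlocks X v y ↔ rowBlock b y ≠ rowBlock b (X.mulVec v) := by
  simp [wrongBlocks]

/-- The outcome of one trial with planted block `I`, known summand `N` and forgiveness pattern `u`,
when the simulated algorithm outputs `y`. The trial is accepted if each block other than `I` is
correct or forgiven; whether such a block is correct depends only on `N` and `v`. -/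
def decodeTrial (v : Fin n → ZMod p) (I : Fin k) (N : Matrix (Fin (k * d)) (Fin n) (ZMod p))
    (u : Fin k → Bool) (y : Fin (k * d) → ZMod p) : Option (Fin d → ZMod p) :=
  if ∀ b, b ≠ I → b ∈ wrongBlocks N v y → u b = true then
    some (rowBlock I y - rowBlock I (N.mulVec v))
  else none

theorem accept_iff (v : Fin n → ZMod p) (I : Fin k) (N : Matrix (Fin (k * d)) (Fin n) (ZMod p))
    (u : Fin k → Bool) (y : Fin (k * d) → ZMod p) (K : Matrix (Fin d) (Fin n) (ZMod p)) :
    (∀ b, b ≠ I → b ∈ wrongBlocks N v y → u b = true) ↔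
      ∀ b, b ≠ I → b ∈ wrongBlocks (N + plantBlock I K) v y → u b = true :=
  forall_congr' fun b => forall_congr' fun hb => by
    simp [mem_wrongBlocks, rowBlock_mulVec_plantBlock, hb]

theorem decodeTrial_eq_some_iff (v : Fin n → ZMod p) (I : Fin k)
    (N : Matrix (Fin (k * d)) (Fin n) (ZMod p)) (u : Fin k → Bool) (y : Fin (k * d) → ZMod p)
    (K : Matrix (Fin d) (Fin n) (ZMod p)) :
    decodeTrial v I N u y = some (K.mulVec v) ↔
      (∀ b, b ≠ I → b ∈ wrongBlocks (N + plantBlock I K) v y → u b = true) ∧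
        I ∉ wrongBlocks (N + plantBlock I K) v y := by
  rw [decodeTrial, ← accept_iff, mem_wrongBlocks, rowBlock_mulVec_plantBlock, if_pos rfl, not_not]
  split_ifs with h
  · rw [Option.some_inj, sub_eq_iff_eq_add, add_comm]
    exact (and_iff_right h).symm
  · exact iff_of_false (by simp) fun h' => h h'.1

theorem decodeTrial_ne_none_iff (v : Fin n → ZMod p) (I : Fin k)
    (N : Matrix (Fin (k * d)) (Fin n) (ZMod p)) (u : Fin k → Bool) (y : Fin (k * d) → ZMod p)
    (K : Matrix (Fin d) (Fin n) (ZMod p)) :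
    decodeTrial v I N u y ≠ none ↔
      ∀ b, b ≠ I → b ∈ wrongBlocks (N + plantBlock I K) v y → u b = true := by
  rw [decodeTrial, ← accept_iff]
  split_ifs with h
  · exact iff_of_true (by simp) h
  · exact iff_of_false (by simp) h

/-- For a uniform `N` the matrix `N + plantBlock I K` is uniform, whatever `K` is. Hence the
probability of an event about the planted block `I`, the pattern `u` and the set of wrong blocks can
be computed with a uniform matrix that is independent of `I` and `u`. -/
theorem sum_trial_eq [Fact p.Prime] {B : Type} [Fintype B]
    (w : Matrix (Fin (k * d)) (Fin n) (ZMod p) → B → ℝ) (out : B → Fin (k * d) → ZMod p)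
    (v : Fin n → ZMod p) (K : Matrix (Fin d) (Fin n) (ZMod p))
    (c : ℝ) (P : Fin k → (Fin k → Bool) → Finset (Fin k) → Prop) [∀ I u A, Decidable (P I u A)] :
    (∑ x : (Fin k × Matrix (Fin (k * d)) (Fin n) (ZMod p) × (Fin k → Bool)) × B,
      if P x.1.1 x.1.2.2 (wrongBlocks (x.1.2.1 + plantBlock x.1.1 K) v (out x.2)) then
        w (x.1.2.1 + plantBlock x.1.1 K) x.2 / c else 0) =
    (∑ X, ∑ b, w X b * ∑ I, ∑ u, if P I u (wrongBlocks X v (out b)) then 1 else 0) / c := by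
  simp only [Fintype.sum_prod_type]
  have h : ∀ I : Fin k, (∑ N : Matrix (Fin (k * d)) (Fin n) (ZMod p), ∑ u : Fin k → Bool, ∑ b,
      if P I u (wrongBlocks (N + plantBlock I K) v (out b)) then
        w (N + plantBlock I K) b / c else 0) =
      ∑ X, ∑ b, ∑ u, if P I u (wrongBlocks X v (out b)) then w X b / c else 0 := fun I => by
    refine (Equiv.sum_comp (Equiv.addRight (plantBlock I K)) fun X => ∑ u : Fin k → Bool, ∑ b,
      if P I u (wrongBlocks X v (out b)) then w X b / c else 0).trans ?_
    exact Finset.sum_congr rfl fun X _ => Finset.sum_comm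
  simp only [h]
  rw [Finset.sum_comm, Finset.sum_div]
  refine Finset.sum_congr rfl fun X _ => ?_
  rw [Finset.sum_comm, Finset.sum_div]
  refine Finset.sum_congr rfl fun b _ => ?_
  rw [Finset.mul_sum, Finset.sum_div]
  refine Finset.sum_congr rfl fun I _ => ?_
  rw [Finset.mul_sum, Finset.sum_div]
  refine Finset.sum_congr rfl fun u _ => ?_
  split_ifs <;> simp

end Planting

/-! ### The success probability of a trial -/

section Trial

variable {p k d : ℕ} [Fact p.Prime]

/-- For a good vector, a trial yields the correct product with probability at least `α / 2`, and
conditioned on acceptance it is correct with probability at least `1 / 1.0074`. Both hold for every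
`M`. -/
theorem trial_bounds (A : QueryAlg p (k * d) (k * d)) {α : ℝ} (hα : α ≤ 1) (hn : 0 < k * d)
    (hk : 4 * Real.exp (-(k : ℝ) / 3200) ≤ α) {v : Fin (k * d) → ZMod p} (hv : A.IsGood α v)
    (M : Matrix (Fin d) (Fin (k * d)) (ZMod p))
    (q : (Fin k × Matrix (Fin (k * d)) (Fin (k * d)) (ZMod p) × (Fin k → Bool)) ×
      QBasis p (k * d) (k * d) A.W → ℝ)
    (hq : ∀ x, q x = ‖A.finalState (x.1.2.1 + plantBlock x.1.1 M) v x.2‖ ^ 2 /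
      (Fintype.card (Fin k × Matrix (Fin (k * d)) (Fin (k * d)) (ZMod p) × (Fin k → Bool)) : ℝ))
    (dec : (Fin k × Matrix (Fin (k * d)) (Fin (k * d)) (ZMod p) × (Fin k → Bool)) ×
      QBasis p (k * d) (k * d) A.W → Option (Fin d → ZMod p))
    (hdec : ∀ x, dec x = decodeTrial v x.1.1 x.1.2.1 x.1.2.2 x.2.2.2.2.1) :
    ∑ x, q x = 1 ∧
    α / 2 ≤ (∑ x, if dec x = some (M.mulVec v) then q x else 0) ∧
    (∑ x, if dec x ≠ none then q x else 0) ≤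
      1.0074 * ∑ x, if dec x = some (M.mulVec v) then q x else 0 := by
  have hk0 : 0 < k := Nat.pos_of_mul_pos_right hn
  set c : ℝ := (Fintype.card
    (Fin k × Matrix (Fin (k * d)) (Fin (k * d)) (ZMod p) × (Fin k → Bool)) : ℝ) with hc
  set m : ℝ := (Fintype.card (Matrix (Fin (k * d)) (Fin (k * d)) (ZMod p)) : ℝ) with hm
  have hm0 : 0 < m := by rw [hm]; exact_mod_cast Fintype.card_pos
  have hcm : c = m * (k * 2 ^ k) := by
    rw [hc, hm]
    simp only [Fintype.card_prod, Fintype.card_fin, Fintype.card_pi_const, Fintype.card_bool]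
    push_cast
    ring
  have hkpos : (0 : ℝ) < k := by exact_mod_cast hk0
  have hc0 : 0 < c := by rw [hcm]; positivity
  let w : Matrix (Fin (k * d)) (Fin (k * d)) (ZMod p) → QBasis p (k * d) (k * d) A.W → ℝ :=
    fun X b => ‖A.finalState X v b‖ ^ 2
  have hw : ∀ X b, 0 ≤ w X b := fun X b => sq_nonneg _
  have hw1 : ∀ X, ∑ b, w X b = 1 := fun X => A.sum_norm_sq_finalState X v
  let out : QBasis p (k * d) (k * d) A.W → Fin (k * d) → ZMod p := fun b => b.2.2.2.1
  have hg := sum_trial_eq w out v M c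
    (fun I u S => (∀ b, b ≠ I → b ∈ S → u b = true) ∧ I ∉ S)
  have hr := sum_trial_eq w out v M c
    (fun I u S => (∀ b, b ≠ I → b ∈ S → u b = true) ∧ I ∈ S)
  have h1 := sum_trial_eq w out v M c (fun _ _ _ => True)
  simp only [sum_accept_correct] at hg
  simp only [sum_accept_wrong] at hr
  set G := ∑ x, if dec x = some (M.mulVec v) then q x else 0 with hG
  have hG' : G = (∑ X, ∑ b, w X b * (((k : ℝ) - (wrongBlocks X v (out b)).card) *
      (2 ^ k * (1 / 2) ^ (wrongBlocks X v (out b)).card))) / c := by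
    rw [← hg, hG]
    refine Finset.sum_congr rfl fun x _ => ?_
    rw [hdec, hq]
    exact if_congr (decodeTrial_eq_some_iff ..) rfl rfl
  have hAcc : (∑ x, if dec x ≠ none then q x else 0) = G +
      (∑ X, ∑ b, w X b * (((wrongBlocks X v (out b)).card : ℝ) *
      (2 * (2 ^ k * (1 / 2) ^ (wrongBlocks X v (out b)).card)))) / c := by
    rw [hG', ← hr, ← hg, ← Finset.sum_add_distrib]
    refine Finset.sum_congr rfl fun x _ => ?_
    rw [hdec, hq, if_congr (decodeTrial_ne_none_iff v _ _ _ _ M) rfl rfl]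
    by_cases hu : ∀ b, b ≠ x.1.1 →
        b ∈ wrongBlocks (x.1.2.1 + plantBlock x.1.1 M) v x.2.2.2.2.1 → x.1.2.2 b = true
    · by_cases hI : x.1.1 ∈ wrongBlocks (x.1.2.1 + plantBlock x.1.1 M) v x.2.2.2.2.1
      · rw [if_pos hu, if_neg fun h => h.2 hI, if_pos ⟨hu, hI⟩, zero_add]
      · rw [if_pos hu, if_pos ⟨hu, hI⟩, if_neg fun h => hI h.2, add_zero]
    · rw [if_neg hu, if_neg fun h => hu h.1, if_neg fun h => hu h.1, add_zero]
  have hgood : α / 2 ≤ G := by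
    refine hv.trans ?_
    rw [hG', div_le_div_iff₀ hm0 hc0, hcm, mul_left_comm, ← mul_assoc, mul_comm _ m, mul_assoc]
    refine mul_le_mul_of_nonneg_left ?_ hm0.le
    rw [Finset.sum_mul]
    refine Finset.sum_le_sum fun X _ => ?_
    rw [QueryAlg.successProb, QueryAlg.outputProb, Finset.sum_mul]
    refine Finset.sum_le_sum fun b _ => ?_
    split_ifs with hb
    · have h0 : wrongBlocks X v (out b) = ∅ := by
        simp [wrongBlocks, out, hb]
      simp [h0, w]
    · rw [zero_mul]
      refine mul_nonneg (hw X b) (mul_nonneg (sub_nonneg.2 ?_) (by positivity))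
      exact_mod_cast (by simpa using (wrongBlocks X v (out b)).card_le_univ)
  refine ⟨?_, hgood, ?_⟩
  · simp only [if_true, Finset.sum_const, Finset.card_univ, Fintype.card_fin, nsmul_eq_mul, mul_one,
      ← Finset.sum_mul, hw1] at h1
    rw [Fintype.sum_congr _ _ hq]
    refine h1.trans ?_
    rw [Fintype.card_pi_const, Fintype.card_bool, ← hm, hcm, Nat.cast_pow, Nat.cast_ofNat,
      one_mul, div_self (hcm ▸ hc0).ne']
  · have hwrong : (∑ X, ∑ b, w X b * (((wrongBlocks X v (out b)).card : ℝ) *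
        (2 * (2 ^ k * (1 / 2) ^ (wrongBlocks X v (out b)).card)))) / c ≤
        0.0071 * G + 0.0003 * (α / 2) := by
      have hsum : (∑ X, ∑ b, w X b * (((wrongBlocks X v (out b)).card : ℝ) *
          (2 * (2 ^ k * (1 / 2) ^ (wrongBlocks X v (out b)).card)))) ≤
          ∑ X, ∑ b, (0.0071 * (w X b * (((k : ℝ) - (wrongBlocks X v (out b)).card) *
            (2 ^ k * (1 / 2) ^ (wrongBlocks X v (out b)).card))) +
            w X b * (0.0003 * (α / 2) * (k * 2 ^ k))) :=
        Finset.sum_le_sum fun X _ => Finset.sum_le_sum fun b _ =>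
          (mul_le_mul_of_nonneg_left (accept_wrong_le hα hk _) (hw X b)).trans_eq (by ring)
      simp only [Finset.sum_add_distrib, ← Finset.mul_sum, ← Finset.sum_mul, hw1] at hsum
      rw [Finset.sum_const, Finset.card_univ, nsmul_eq_mul, ← hm] at hsum
      rw [div_le_iff₀ hc0]
      refine hsum.trans_eq ?_
      rw [add_mul, mul_assoc (0.0071 : ℝ) G c, hG', div_mul_cancel₀ _ hc0.ne', hcm]
      ring
    rw [hAcc]
    linarith

end Trial

/-! ### The reduction -/

/-- The reduction works for every matrix, not only for most of them, and needs `30 / α` times the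
queries of the given algorithm. -/
theorem exists_worstCase_alg {p k d : ℕ} [Fact p.Prime] {α : ℝ} (hn : 0 < k * d) (hα : α ≤ 1)
    (hk : 4 * Real.exp (-(k : ℝ) / 3200) ≤ α) (A : QueryAlg p (k * d) (k * d)) :
    ∃ A₁ : QueryAlg p d (k * d), (A₁.matQueries : ℝ) ≤ 30 * (α⁻¹ * A.matQueries) ∧
      ∀ v, A.IsGood α v → ∀ M, (99 / 100 : ℝ) ≤ A₁.successProb M v := by
  have hα0 : 0 < α := lt_of_lt_of_le (by positivity) hk
  have hk0 : 0 < k := Nat.pos_of_mul_pos_right hn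
  have hd0 : 0 < d := Nat.pos_of_mul_pos_left hn
  -- A trial is accepted with probability at least `α / 2`, so all of `14 / α` trials are rejected
  -- with probability at most `exp (-7)`.
  set T : ℕ := ⌈14 / α⌉₊ with hT
  have hT1 : 14 / α ≤ T := Nat.le_ceil _
  have hT2 : (T : ℝ) ≤ 15 / α := by
    have h1 : (T : ℝ) < 14 / α + 1 := Nat.ceil_lt_add_one (by positivity)
    have h2 : 1 ≤ 1 / α := by rw [le_div_iff₀ hα0]; linarith
    have h3 : 15 / α = 14 / α + 1 / α := by ring
    linarith
  have : Nonempty (Fin k) := ⟨⟨0, hk0⟩⟩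
  let dec : (Fin (k * d) → ZMod p) →
      (Fin k × Matrix (Fin (k * d)) (Fin (k * d)) (ZMod p) × (Fin k → Bool)) ×
        QBasis p (k * d) (k * d) A.W → Option (Fin d → ZMod p) :=
    fun v x => decodeTrial v x.1.1 x.1.2.1 x.1.2.2 x.2.2.2.2.1
  obtain ⟨A₁, hQ, hA₁⟩ := exists_simulation
    (S := Fin k × Matrix (Fin (k * d)) (Fin (k * d)) (ZMod p) × (Fin k → Bool)) hd0 hn A T
    (fun s K => s.2.1 + plantBlock s.1 K)
    (fun _ i j => ((finProdFinEquiv.symm i).2, j)) (fun s K i j => by simp [plantBlock])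
    (fun v c => (firstSome fun t => dec v (c t)).getD 0)
  refine ⟨A₁, ?_, fun v hv M => ?_⟩
  · rw [hQ]
    push_cast
    have h : (A.matQueries : ℝ) * T ≤ A.matQueries * (15 / α) := by gcongr
    have h' : 30 * (α⁻¹ * (A.matQueries : ℝ)) = 2 * (A.matQueries * (15 / α)) := by ring
    linarith
  · set q : (Fin k × Matrix (Fin (k * d)) (Fin (k * d)) (ZMod p) × (Fin k → Bool)) ×
        QBasis p (k * d) (k * d) A.W → ℝ := fun x =>
      ‖A.finalState (x.1.2.1 + plantBlock x.1.1 M) v x.2‖ ^ 2 / (Fintype.card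
        (Fin k × Matrix (Fin (k * d)) (Fin (k * d)) (ZMod p) × (Fin k → Bool)) : ℝ) with hq
    have hq0 : ∀ x, 0 ≤ q x := fun x => by positivity
    obtain ⟨h1, hg, ha⟩ := trial_bounds A hα hn hk hv M q (fun _ => rfl) (dec v) fun _ => rfl
    have hrep := mul_sum_firstSome q h1 (dec v) (M.mulVec v) T
    set g := ∑ x, if dec v x = some (M.mulVec v) then q x else 0
    set a := ∑ x, if dec v x ≠ none then q x else 0 with ha'
    set P := ∑ c : Fin T → (Fin k × Matrix (Fin (k * d)) (Fin (k * d)) (ZMod p) × (Fin k → Bool)) ×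
        QBasis p (k * d) (k * d) A.W,
      if firstSome (fun t => dec v (c t)) = some (M.mulVec v) then ∏ t, q (c t) else 0 with hP
    have hle : P ≤ A₁.successProb M v := by
      rw [QueryAlg.successProb, hA₁, hP]
      refine Finset.sum_le_sum fun c _ => ?_
      have hc : 0 ≤ ∏ t, q (c t) := Finset.prod_nonneg fun t _ => hq0 _
      by_cases h : firstSome (fun t => dec v (c t)) = some (M.mulVec v)
      · rw [if_pos h, if_pos (by rw [h]; rfl)]
      · rw [if_neg h]
        split_ifs
        · exact hc
        · exact le_rfl
    refine le_trans ?_ hle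
    have hga : g ≤ a := Finset.sum_le_sum fun x _ => by
      by_cases h : dec v x = some (M.mulVec v)
      · simp [h]
      · rw [if_neg h]
        split_ifs
        · exact hq0 x
        · exact le_rfl
    have ha1 : a ≤ 1 := by
      rw [← h1]
      refine Finset.sum_le_sum fun x _ => ?_
      split_ifs
      · exact le_rfl
      · exact hq0 x
    have ha0 : 0 < a := by linarith
    have hg0 : 0 < g := by linarith
    have hrej : (1 - a) ^ T ≤ 0.001 := by
      have hbase : 1 - a ≤ Real.exp (-(α / 2)) := by
        have := Real.add_one_le_exp (-(α / 2))
        linarith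
      have hT7 : 7 ≤ T * (α / 2) := by
        rw [div_le_iff₀ hα0] at hT1
        linarith
      calc (1 - a) ^ T ≤ Real.exp (-(α / 2)) ^ T := by gcongr
        _ = Real.exp (T * -(α / 2)) := (Real.exp_nat_mul _ _).symm
        _ ≤ Real.exp (-7) := Real.exp_le_exp.2 (by linarith)
        _ ≤ 0.001 := by
          have h := Real.exp_one_gt_d9
          have h' : (2.7 : ℝ) ^ 7 ≤ Real.exp 1 ^ 7 := by gcongr; linarith
          rw [← Real.exp_nat_mul] at h'
          norm_num at h'
          rw [Real.exp_neg]
          refine inv_le_of_inv_le₀ (by norm_num) (le_trans ?_ h')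
          norm_num
    have h2 : g * 0.999 ≤ a * P := by
      rw [hrep]
      exact mul_le_mul_of_nonneg_left (by linarith) hg0.le
    by_contra hlt
    rw [not_le] at hlt
    have h3 : a * P < a * (99 / 100) := mul_lt_mul_of_pos_left hlt ha0
    linarith

theorem mainTheorem2 :
    ∃ C : ℝ, 0 < C ∧
      ∀ (p : ℕ) [Fact p.Prime] (n k d : ℕ) (α : ℝ) (Q : ℕ),
        0 < n → n = k * d → 0 < α → α ≤ 1 → 4 * Real.exp (-(k : ℝ) / 3200) ≤ α →
        ∀ ALG : QueryAlg p n n, ALG.matQueries ≤ Q →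
          ∃ ALG₁ : QueryAlg p d n,
            (ALG₁.matQueries : ℝ) ≤ C * (α⁻¹ * ((Q : ℝ) + (n : ℝ) ^ (3 / 2 : ℝ))) ∧
            ∀ v : Fin n → ZMod p, ALG.IsGood α v →
              (99 / 100 : ℝ) ≤ uniformProb
                (fun M : Matrix (Fin d) (Fin n) (ZMod p) =>
                  (99 / 100 : ℝ) ≤ ALG₁.successProb M v) := by
  refine ⟨30, by norm_num, fun p _ n k d α Q hn hnk hα0 hα hk ALG hQ => ?_⟩
  subst hnk
  obtain ⟨A₁, hA₁, hsucc⟩ := exists_worstCase_alg hn hα hk ALG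
  refine ⟨A₁, hA₁.trans ?_, fun v hv => ?_⟩
  · have hQ' : (ALG.matQueries : ℝ) ≤ Q := by exact_mod_cast hQ
    have hpow : 0 ≤ ((k * d : ℕ) : ℝ) ^ (3 / 2 : ℝ) := by positivity
    gcongr
    linarith
  · have h : ∀ M : Matrix (Fin d) (Fin (k * d)) (ZMod p),
        (99 / 100 : ℝ) ≤ A₁.successProb M v := hsucc v hv
    have hcard : Nat.card {M : Matrix (Fin d) (Fin (k * d)) (ZMod p) //
        (99 / 100 : ℝ) ≤ A₁.successProb M v} =
          Fintype.card (Matrix (Fin d) (Fin (k * d)) (ZMod p)) := by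
      rw [Nat.card_congr (Equiv.subtypeUnivEquiv h), Nat.card_eq_fintype_card]
    rw [uniformProb, hcard, div_self (by exact_mod_cast Fintype.card_ne_zero)]
    norm_num
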